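/- Let $\mathcal N_n=\{K\in\mathbb R^{n\times n}: K^T=-K\}$ be the manifold (real vector space) of real $n\times n$ skew-symmetric matrices. Eigenvalues are taken in $\mathbb C$; $K$ is called derogatory if some eigenvalue has geometric multiplicity at least $2$. A set $S\subseteq\mathcal N_n$ is said to have codimension $c$ if it is a countable union of smooth embedded submanifolds of $\mathcal N_n$, each of codimension at least $c$, at least one of them being nonempty and of codimension exactly $c$ (where a submanifold $\mathcal M$ has codimension $\dim\mathcal N_n-\dim\mathcal M$). (1) The set of derogatory matrices in $\mathcal N_n$ has codimension $1$ if $n\ge 2$ is even, and codimension $3$ if $n\ge 3$ is odd. (2) For $n\ge 4$, the set of matrices in $\mathcal N_n$ having a nonzero eigenvalue of (algebraic) multiplicity at least $2$ has codimension $3$. For $n\le 3$ this set is empty. (3) Let $n\ge2$ be even. The matrices in $\mathcal N_n$ for which $0$ is an eigenvalue of (algebraic) multiplicity at least $2$ are exactly those with $\det K=0$; they form a set of codimension $1$, and the derogatory matrices are exactly those with $\det K=0$ or with a nonzero eigenvalue of multiplicity at least $2$. (Thus, by (2), the codimension $1$ in (1) comes entirely from the double eigenvalue at $0$.) -/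

import Mathlib

open scoped ContDiff

noncomputable section

/-- The real vector space of real `n × n` skew-symmetric matrices, `Kᵀ = -K`. -/
def skewSymm (n : ℕ) : Submodule ℝ (Matrix (Fin n) (Fin n) ℝ) where
  carrier := {K | K.transpose = -K}
  add_mem' := by
    intro A B hA hB
    simp only [Set.mem_ofPred_eq] at hA hB ⊢
    rw [Matrix.transpose_add, hA, hB, neg_add]
  zero_mem' := by simp
  smul_mem' := by
    intro c A hA
    simp only [Set.mem_ofPred_eq] at hA ⊢
    rw [Matrix.transpose_smul, hA, smul_neg]

/-- The space of skew-symmetric matrices with the entrywise maximum norm. It is finite dimensional,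
so its topology and its smooth structure do not depend on the choice of the norm. -/
instance skewSymm.normedAddCommGroup (n : ℕ) : NormedAddCommGroup (skewSymm n) :=
  @Submodule.normedAddCommGroup ℝ (Matrix (Fin n) (Fin n) ℝ) _ Matrix.normedAddCommGroup _
    (skewSymm n)

instance skewSymm.normedSpace (n : ℕ) : NormedSpace ℝ (skewSymm n) :=
  @Submodule.normedSpace ℝ ℝ _ _ _ (Matrix (Fin n) (Fin n) ℝ) Matrix.seminormedAddCommGroup
    Matrix.normedSpace _ _ (skewSymm n)

/-- `M` is a smooth embedded submanifold of codimension `c` of the finite-dimensional space `E`: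
around each of its points, `M` is the zero set of a smooth submersion to `ℝ^c`. Thus
`dim E - dim M = c`. The empty set counts as a submanifold of every codimension. -/
def IsSubmanifoldOfCodim {E : Type*} [NormedAddCommGroup E] [NormedSpace ℝ E]
    (M : Set E) (c : ℕ) : Prop :=
  ∀ x ∈ M, ∃ U : Set E, IsOpen U ∧ x ∈ U ∧ ∃ f : E → (Fin c → ℝ),
    ContDiffOn ℝ ∞ f U ∧ (∀ y ∈ U, Function.Surjective (fderiv ℝ f y)) ∧
      M ∩ U = {y | y ∈ U ∧ f y = 0}

/-- The set `S`, which may be singular, has codimension `c` in `E`: it is a countable union of smooth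
embedded submanifolds of `E`, all of codimension at least `c`, and one of them is nonempty of
codimension exactly `c`. (Finite unions are included, since members may be empty.) -/
def HasCodim {E : Type*} [NormedAddCommGroup E] [NormedSpace ℝ E] (S : Set E) (c : ℕ) : Prop :=
  ∃ (M : ℕ → Set E) (k : ℕ → ℕ),
    (∀ i, IsSubmanifoldOfCodim (M i) (k i) ∧ c ≤ k i) ∧
      S = ⋃ i, M i ∧ ∃ i, k i = c ∧ (M i).Nonempty

/-- A real matrix, regarded as a complex one. -/
def complexify {n : ℕ} (K : Matrix (Fin n) (Fin n) ℝ) : Matrix (Fin n) (Fin n) ℂ :=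
  K.map (fun x : ℝ => (x : ℂ))

/-- A real matrix is derogatory if some complex eigenvalue has geometric multiplicity at least 2. -/
def IsDerogatory {n : ℕ} (K : Matrix (Fin n) (Fin n) ℝ) : Prop :=
  ∃ z : ℂ, 2 ≤ Module.finrank ℂ
    (Module.End.eigenspace (Matrix.toLin' (complexify K)) z)

/-- `z` is an eigenvalue of the real matrix `K` of algebraic multiplicity at least 2. -/
def IsRepeatedEigenvalue {n : ℕ} (K : Matrix (Fin n) (Fin n) ℝ) (z : ℂ) : Prop :=
  2 ≤ (complexify K).charpoly.rootMultiplicity z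

/-- The derogatory real skew-symmetric matrices. -/
def derogatorySkew (n : ℕ) : Set (skewSymm n) :=
  {K | IsDerogatory (K : Matrix (Fin n) (Fin n) ℝ)}

/-- The real skew-symmetric matrices with a repeated nonzero eigenvalue. -/
def repeatedNonzeroSkew (n : ℕ) : Set (skewSymm n) :=
  {K | ∃ z : ℂ, z ≠ 0 ∧ IsRepeatedEigenvalue (K : Matrix (Fin n) (Fin n) ℝ) z}

/-- The real skew-symmetric matrices for which `0` is a repeated eigenvalue. -/
def repeatedZeroSkew (n : ℕ) : Set (skewSymm n) :=
  {K | IsRepeatedEigenvalue (K : Matrix (Fin n) (Fin n) ℝ) 0}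

end

/-!
Near a skew-Hermitian matrix `A` whose kernel has dimension `m`, the skew-Hermitian matrices with
kernel of dimension `m` are the zeros of a map to the skew-Hermitian `m × m` matrices, whose
derivative at `A` is the compression `X ↦ Vᴴ X V` to the kernel, `V` being an orthonormal basis.
On real skew-symmetric matrices this compression is onto, so kernel dimension `m` costs
`m (m - 1) / 2` parameters. The kernel dimension has the parity of `n`, so a double eigenvalue `0`
means `m ≥ 2` for even `n` and `m ≥ 3` for odd `n`: codimension `1` and `3` respectively.

A nonzero eigenvalue `μ i` of multiplicity `m` is a kernel of dimension `m` of `K - μ i`. For such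
an eigenvalue `Vᵀ V = 0`, which makes the compression onto even though `K` varies over real matrices
only. The pairs `(K, μ)` thus satisfy `m ^ 2` independent equations, one of which determines `μ` in
terms of `K`; the matrices `K` satisfy the other `m ^ 2 - 1 ≥ 3`.

The eigenvalues are semisimple because skew-Hermitian matrices are normal, so geometric and
algebraic multiplicities agree.
-/

open Filter Module Topology
open scoped ComplexOrder Matrix

section Submanifold

variable {E G H : Type*} [NormedAddCommGroup E] [NormedSpace ℝ E] [NormedAddCommGroup G]
  [NormedSpace ℝ G] [NormedAddCommGroup H] [NormedSpace ℝ H]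

theorem eventually_surjective_of_surjective [FiniteDimensional ℝ G] {L : E →L[ℝ] G}
    (hL : Function.Surjective L) : ∀ᶠ L' : E →L[ℝ] G in 𝓝 L, Function.Surjective L' := by
  have : CompleteSpace G := FiniteDimensional.complete ℝ G
  obtain ⟨R, hR⟩ := L.exists_rightInverse_of_surjective (LinearMap.range_eq_top.2 hL)
  have hcont : Continuous fun L' : E →L[ℝ] G ↦ L'.comp R := by fun_prop
  have hunits : {T : G →L[ℝ] G | IsUnit T} ∈ 𝓝 (L.comp R) := by
    rw [hR]
    exact Units.isOpen.mem_nhds isUnit_one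
  filter_upwards [hcont.continuousAt.preimage_mem_nhds hunits] with L' hL'
  exact .of_comp (g := R) (ContinuousLinearMap.isUnit_iff_bijective.1 hL').surjective

/-- `f` is real-analytic at `x` and its derivative there is surjective. Analyticity is required
rather than smoothness because it spreads to a neighbourhood, whereas `ContDiffAt ℝ ∞ f x` only
says that each finite order of differentiability does. -/
def IsAnalyticSubmersionAt (f : E → G) (x : E) : Prop :=
  ContDiffAt ℝ ω f x ∧ Function.Surjective (fderiv ℝ f x)

theorem IsAnalyticSubmersionAt.eventually [FiniteDimensional ℝ G] {f : E → G} {x : E}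
    (hf : IsAnalyticSubmersionAt f x) : ∀ᶠ y in 𝓝 x, IsAnalyticSubmersionAt f y := by
  have hcont : ContinuousAt (fderiv ℝ f) x := (hf.1.fderiv_right (m := 0) (by simp)).continuousAt
  exact (hf.1.eventually (by simp)).and
    (hcont.eventually (eventually_surjective_of_surjective hf.2))

theorem IsAnalyticSubmersionAt.continuousLinearEquiv_comp {f : E → G} {x : E}
    (hf : IsAnalyticSubmersionAt f x) (e : G ≃L[ℝ] H) : IsAnalyticSubmersionAt (e ∘ f) x := by
  refine ⟨e.contDiff.contDiffAt.comp x hf.1, ?_⟩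
  rw [e.comp_fderiv]
  exact e.surjective.comp hf.2

theorem isSubmanifoldOfCodim_of_eventually [FiniteDimensional ℝ G] {M : Set E}
    (h : ∀ x ∈ M, ∃ f : E → G, IsAnalyticSubmersionAt f x ∧ ∀ᶠ y in 𝓝 x, y ∈ M ↔ f y = 0) :
    IsSubmanifoldOfCodim M (finrank ℝ G) := by
  intro x hx
  obtain ⟨f, hf, hM⟩ := h x hx
  have e : G ≃L[ℝ] (Fin (finrank ℝ G) → ℝ) := (finBasis ℝ G).equivFunL
  obtain ⟨U, hU, hUo, hxU⟩ := eventually_nhds_iff.1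
    ((hf.continuousLinearEquiv_comp e).eventually.and hM)
  refine ⟨U, hUo, hxU, e ∘ f, fun y hy ↦ ((hU y hy).1.1.of_le le_top).contDiffWithinAt,
    fun y hy ↦ (hU y hy).1.2, Set.ext fun y ↦ ?_⟩
  simp only [Set.mem_inter_iff, Set.mem_ofPred_eq, Function.comp_apply,
    EmbeddingLike.map_eq_zero_iff]
  exact ⟨fun hy ↦ ⟨hy.2, (hU y hy.2).2.1 hy.1⟩, fun hy ↦ ⟨(hU y hy.1).2.2 hy.2, hy.1⟩⟩

theorem exists_isSubmanifoldOfCodim_image_fst_of_graph {Y : Type*} [TopologicalSpace Y]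
    [FiniteDimensional ℝ H] {T : Set (E × Y)} {u : E × Y} {τ : E → Y} {f : E → H}
    (hτ : ContinuousAt τ u.1) (hτu : τ u.1 = u.2)
    (hf : IsAnalyticSubmersionAt f u.1) (hT : ∀ᶠ v in 𝓝 u, v ∈ T ↔ τ v.1 = v.2 ∧ f v.1 = 0) :
    ∃ W ∈ 𝓝 u, IsSubmanifoldOfCodim (Prod.fst '' (T ∩ W)) (finrank ℝ H) := by
  obtain ⟨U₁, hU₁, V, hV, hUV⟩ := mem_nhds_prod_iff.1 hT
  have hτV : ∀ᶠ x in 𝓝 u.1, τ x ∈ V := hτ.eventually_mem (by rwa [hτu])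
  obtain ⟨U, hU, hUo, huU⟩ := eventually_nhds_iff.1
    (hf.eventually.and (hτV.and (eventually_mem_set.2 hU₁)))
  refine ⟨U ×ˢ V, prod_mem_nhds (hUo.mem_nhds huU) hV, isSubmanifoldOfCodim_of_eventually ?_⟩
  rintro _ ⟨⟨x, _⟩, ⟨-, hxU, -⟩, rfl⟩
  refine ⟨f, (hU x hxU).1, ?_⟩
  filter_upwards [hUo.mem_nhds hxU] with y hy
  constructor
  · rintro ⟨⟨y, z⟩, ⟨hyT, hyU, hzV⟩, rfl⟩
    exact ((hUV ⟨(hU y hyU).2.2, hzV⟩).1 hyT).2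
  · intro hfy
    obtain ⟨-, hyV, hyU₁⟩ := hU y hy
    exact ⟨(y, τ y), ⟨(hUV ⟨hyU₁, hyV⟩).2 ⟨rfl, hfy⟩, hy, hyV⟩, rfl⟩

theorem isAnalyticSubmersionAt_comp_graph {F : E × G → H} {τ : E → G} {x : E}
    {H' : Type*} [NormedAddCommGroup H'] [NormedSpace ℝ H']
    (hF : ContDiffAt ℝ ω F (x, τ x)) (hτ : ContDiffAt ℝ ω τ x)
    (hs : Function.Surjective fun e : E ↦ fderiv ℝ F (x, τ x) (e, 0))
    {p : H →L[ℝ] H'} (hp : Function.Surjective p)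
    (hpF : ∀ g : G, p (fderiv ℝ F (x, τ x) (0, g)) = 0) :
    IsAnalyticSubmersionAt (fun y ↦ p (F (y, τ y))) x := by
  have hgraph : ContDiffAt ℝ ω (fun y ↦ (y, τ y)) x := contDiffAt_id.prodMk hτ
  refine ⟨p.contDiff.contDiffAt.comp x (hF.comp x hgraph), fun z ↦ ?_⟩
  have hdτ : HasFDerivAt τ (fderiv ℝ τ x) x := (hτ.differentiableAt (by simp)).hasFDerivAt
  have hdF : HasFDerivAt F (fderiv ℝ F (x, τ x)) (x, τ x) :=
    (hF.differentiableAt (by simp)).hasFDerivAt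
  have hd : HasFDerivAt (fun y ↦ p (F (y, τ y)))
      (p.comp ((fderiv ℝ F (x, τ x)).comp ((ContinuousLinearMap.id ℝ E).prod (fderiv ℝ τ x)))) x :=
    p.hasFDerivAt.comp x (hdF.comp x ((hasFDerivAt_id x).prodMk hdτ))
  obtain ⟨h, rfl⟩ := hp z
  obtain ⟨e, rfl⟩ := hs h
  refine ⟨e, ?_⟩
  calc fderiv ℝ (fun y ↦ p (F (y, τ y))) x e = p (fderiv ℝ F (x, τ x) (e, fderiv ℝ τ x e)) := by
        rw [hd.fderiv]; rfl
    _ = p (fderiv ℝ F (x, τ x) (e, 0) + fderiv ℝ F (x, τ x) (0, fderiv ℝ τ x e)) := by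
        rw [← map_add, Prod.mk_add_mk, add_zero, zero_add]
    _ = p (fderiv ℝ F (x, τ x) (e, 0)) := by rw [map_add, hpF, add_zero]

theorem exists_leftInverse_finrank_ker [FiniteDimensional ℝ H] {j : G →L[ℝ] H}
    (hj : Function.Injective j) :
    ∃ L : H →L[ℝ] G, Function.LeftInverse L j ∧ finrank ℝ L.ker = finrank ℝ H - finrank ℝ G := by
  obtain ⟨l, hl⟩ := j.toLinearMap.exists_leftInverse_of_injective (LinearMap.ker_eq_bot.2 hj)
  have hlj : Function.LeftInverse l j := LinearMap.congr_fun hl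
  refine ⟨l.toContinuousLinearMap, hlj, Nat.eq_sub_of_add_eq' ?_⟩
  rw [← l.finrank_range_add_finrank_ker, LinearMap.range_eq_top.2 hlj.surjective, finrank_top]
  rfl

theorem exists_isSubmanifoldOfCodim_image_fst [CompleteSpace E] [FiniteDimensional ℝ G]
    [FiniteDimensional ℝ H] {T : Set (E × G)} {F : E × G → H} {u : E × G} (huT : u ∈ T)
    (hF : ContDiffAt ℝ ω F u) (hT : ∀ᶠ v in 𝓝 u, v ∈ T ↔ F v = 0)
    (hs : Function.Surjective fun e : E ↦ fderiv ℝ F u (e, 0))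
    (hi : Function.Injective fun g : G ↦ fderiv ℝ F u (0, g)) :
    ∃ W ∈ 𝓝 u, IsSubmanifoldOfCodim (Prod.fst '' (T ∩ W)) (finrank ℝ H - finrank ℝ G) := by
  have : CompleteSpace G := FiniteDimensional.complete ℝ G
  let j : G →L[ℝ] H := fderiv ℝ F u ∘L .inr ℝ E G
  obtain ⟨L, hLj, hker⟩ := exists_leftInverse_finrank_ker (j := j) hi
  let p : H →L[ℝ] L.ker := L.projKerOfRightInverse j hLj
  have hp : Function.Surjective p := fun y ↦ ⟨y, L.projKerOfRightInverse_apply_idem j hLj y⟩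
  have hFu : F u = 0 := hT.self_of_nhds.1 huT
  have hLF : ContDiffAt ℝ ω (L ∘ F) u := L.contDiff.contDiffAt.comp u hF
  have hinv : (fderiv ℝ (L ∘ F) u ∘L .inr ℝ E G).IsInvertible := by
    refine ⟨.refl ℝ G, ContinuousLinearMap.ext fun g ↦ ?_⟩
    rw [(L.hasFDerivAt.comp u (hF.differentiableAt (by simp)).hasFDerivAt).fderiv]
    exact (hLj g).symm
  -- `L ∘ F = 0` is solved for the second variable; the remaining equations cut out the projection.
  set τ := hLF.implicitFunction (by simp) hinv
  have hτu : τ u.1 = u.2 := hLF.implicitFunction_apply_self _ hinv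
  have hτ : ContDiffAt ℝ ω τ u.1 := hLF.contDiffAt_implicitFunction _ hinv
  have hτ_iff : ∀ᶠ v in 𝓝 u, L (F v) = 0 ↔ τ v.1 = v.2 := by
    simpa [hFu] using hLF.eventually_apply_eq_iff_implicitFunction (by simp) hinv
  have hu : (u.1, τ u.1) = u := by rw [hτu]
  have hf : IsAnalyticSubmersionAt (fun y ↦ p (F (y, τ y))) u.1 :=
    isAnalyticSubmersionAt_comp_graph (by rwa [hu]) hτ (by rwa [hu]) hp
      (by rw [hu]; exact L.projKerOfRightInverse_comp_inv j hLj)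
  rw [← hker]
  refine exists_isSubmanifoldOfCodim_image_fst_of_graph hτ.continuousAt hτu hf ?_
  filter_upwards [hT, hτ_iff] with v hv hτv
  rw [hv, ← hτv]
  refine ⟨fun h ↦ ?_, fun ⟨hLv, hpv⟩ ↦ ?_⟩
  · have hLv : L (F v) = 0 := by rw [h, map_zero]
    exact ⟨hLv, by rw [hτv.1 hLv, h, map_zero]⟩
  · have hpval := congrArg Subtype.val hpv
    simpa [p, hτv.1 hLv, hLv] using hpval

/-- `S` is a countable union of submanifolds of codimension at least `c`: the upper bound on the
size of `S` that is part of `HasCodim S c`. -/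
def CodimAtLeast (S : Set E) (c : ℕ) : Prop :=
  ∃ (M : ℕ → Set E) (k : ℕ → ℕ), (∀ i, IsSubmanifoldOfCodim (M i) (k i) ∧ c ≤ k i) ∧ S = ⋃ i, M i

theorem IsSubmanifoldOfCodim.codimAtLeast {M : Set E} {k : ℕ} (h : IsSubmanifoldOfCodim M k) :
    CodimAtLeast M k :=
  ⟨fun _ ↦ M, fun _ ↦ k, fun _ ↦ ⟨h, le_rfl⟩, (Set.iUnion_const M).symm⟩

namespace CodimAtLeast

theorem mono {S : Set E} {c c' : ℕ} (h : CodimAtLeast S c) (hc : c' ≤ c) :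
    CodimAtLeast S c' := by
  obtain ⟨M, k, hk, hS⟩ := h
  exact ⟨M, k, fun i ↦ ⟨(hk i).1, hc.trans (hk i).2⟩, hS⟩

theorem iUnion {ι : Type*} [Countable ι] {S : ι → Set E} {c : ℕ}
    (h : ∀ i, CodimAtLeast (S i) c) : CodimAtLeast (⋃ i, S i) c := by
  rcases isEmpty_or_nonempty ι with hι | hι
  · refine ⟨fun _ ↦ ∅, fun _ ↦ c, fun _ ↦ ⟨fun x hx ↦ hx.elim, le_rfl⟩, by simp⟩
  · choose M k hk hS using h
    obtain ⟨g, hg⟩ := exists_surjective_nat (ι × ℕ)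
    refine ⟨fun j ↦ M (g j).1 (g j).2, fun j ↦ k (g j).1 (g j).2, fun j ↦ hk _ _, ?_⟩
    rw [hg.iUnion_comp fun p : ι × ℕ ↦ M p.1 p.2, Set.iUnion_prod']
    exact Set.iUnion_congr hS

theorem union {S S' : Set E} {c : ℕ} (h : CodimAtLeast S c) (h' : CodimAtLeast S' c) :
    CodimAtLeast (S ∪ S') c := by
  rw [Set.union_eq_iUnion]
  exact iUnion (Bool.forall_bool.2 ⟨h', h⟩)

theorem image_of_locally {X : Type*} [TopologicalSpace X] [SecondCountableTopology X] {f : X → E}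
    {T : Set X} {c : ℕ} (h : ∀ p ∈ T, ∃ W ∈ 𝓝 p, CodimAtLeast (f '' (T ∩ W)) c) :
    CodimAtLeast (f '' T) c := by
  choose! W hW hM using h
  obtain ⟨t, ht, htc, hcov⟩ := TopologicalSpace.countable_cover_nhdsWithin
    fun p hp ↦ mem_nhdsWithin_of_mem_nhds (hW p hp)
  have hT : f '' T = ⋃ p : t, f '' (T ∩ W p) := by
    rw [← Set.image_iUnion, ← Set.inter_iUnion, ← Set.biUnion_eq_iUnion t fun p _ ↦ W p,
      Set.inter_eq_left.2 hcov]
  have := htc.to_subtype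
  rw [hT]
  exact iUnion fun p ↦ hM p (ht p.2)

theorem hasCodim {S M : Set E} {c : ℕ} (h : CodimAtLeast S c) (hM : IsSubmanifoldOfCodim M c)
    (hMS : M ⊆ S) (hne : M.Nonempty) : HasCodim S c := by
  obtain ⟨N, k, hk, rfl⟩ := h
  refine ⟨fun i ↦ Nat.casesOn i M N, fun i ↦ Nat.casesOn i c k, ?_, ?_, 0, rfl, hne⟩
  · rintro (_ | i)
    exacts [⟨hM, le_rfl⟩, hk i]
  · calc ⋃ i, N i = M ∪ ⋃ i, N i := (Set.union_eq_right.2 hMS).symm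
      _ = _ := Set.union_iUnion_nat_succ fun i ↦ Nat.casesOn i M N

end CodimAtLeast

theorem HasCodim.union {S S' : Set E} {c : ℕ} (h : HasCodim S c) (h' : CodimAtLeast S' c) :
    HasCodim (S ∪ S') c := by
  obtain ⟨M, k, hk, hS, i, rfl, hne⟩ := h
  exact (CodimAtLeast.union ⟨M, k, hk, hS⟩ h').hasCodim (hk i).1
    ((Set.subset_iUnion M i).trans_eq hS.symm |>.trans Set.subset_union_left) hne

end Submanifold

section Nullity

variable {ι κ R : Type*} [Fintype ι] [Fintype κ]

/-- The dimension of the kernel of a square matrix. -/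
noncomputable def nullity [CommRing R] (A : Matrix ι ι R) : ℕ :=
  finrank R (LinearMap.ker A.mulVecLin)

variable [DecidableEq ι] [DecidableEq κ]

theorem nullity_one_sub_mul_inv_mul [CommRing R] {B : Matrix ι ι R} {U : Matrix κ ι R}
    {V : Matrix ι κ R} (hD : IsUnit (B + V * U)) :
    nullity (1 - U * (B + V * U)⁻¹ * V) = nullity B := by
  set D := B + V * U with hD_def
  have hdet := (Matrix.isUnit_iff_isUnit_det D).1 hD
  have hker {w : κ → R} (hw : (1 - U * D⁻¹ * V) *ᵥ w = 0) : U *ᵥ (D⁻¹ * V) *ᵥ w = w := by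
    rw [Matrix.sub_mulVec, Matrix.one_mulVec, sub_eq_zero] at hw
    rw [Matrix.mulVec_mulVec, ← Matrix.mul_assoc, ← hw]
  have hinv {x : ι → R} (hx : B *ᵥ x = 0) : (D⁻¹ * V) *ᵥ U *ᵥ x = x := by
    have hDx : D *ᵥ x = V *ᵥ U *ᵥ x := by rw [hD_def, Matrix.add_mulVec, hx, zero_add,
      Matrix.mulVec_mulVec]
    rw [← Matrix.mulVec_mulVec, ← hDx, Matrix.mulVec_mulVec, Matrix.nonsing_inv_mul _ hdet,
      Matrix.one_mulVec]
  refine LinearEquiv.finrank_eq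
    { LinearMap.restrict (D⁻¹ * V).mulVecLin (p := LinearMap.ker (1 - U * D⁻¹ * V).mulVecLin)
        (q := LinearMap.ker B.mulVecLin) fun w hw ↦ ?_ with
      invFun := fun x ↦ ⟨U *ᵥ x.1, ?_⟩
      left_inv := fun w ↦ Subtype.ext (hker w.2)
      right_inv := fun x ↦ Subtype.ext (hinv x.2) }
  · have hB : B = D - V * U := by rw [hD_def, add_sub_cancel_right]
    rw [LinearMap.mem_ker, Matrix.mulVecLin_apply, Matrix.mulVecLin_apply, hB, Matrix.sub_mulVec,
      ← Matrix.mulVec_mulVec (M := V), hker hw, Matrix.mulVec_mulVec,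
      Matrix.mul_nonsing_inv_cancel_left _ _ hdet, sub_self]
  · rw [LinearMap.mem_ker, Matrix.mulVecLin_apply, Matrix.sub_mulVec, Matrix.one_mulVec,
      Matrix.mul_assoc, ← Matrix.mulVec_mulVec, hinv x.2, sub_self]

omit [DecidableEq ι] in
theorem nullity_eq_card_iff [Field R] {A : Matrix ι ι R} : nullity A = Fintype.card ι ↔ A = 0 := by
  classical
  rw [← finrank_fintype_fun_eq_card R, nullity]
  refine ⟨fun h ↦ ?_, fun h ↦ by rw [h, Matrix.mulVecLin_zero, LinearMap.ker_zero, finrank_top]⟩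
  have htop := LinearMap.ker_eq_top.1 (Submodule.eq_top_of_finrank_eq h)
  rwa [← Matrix.toLin'_apply', LinearEquiv.map_eq_zero_iff] at htop

theorem mul_inv_mul_eq_one_iff_nullity_eq [Field R] {B : Matrix ι ι R} {U : Matrix κ ι R}
    {V : Matrix ι κ R} (hD : IsUnit (B + V * U)) :
    U * (B + V * U)⁻¹ * V = 1 ↔ nullity B = Fintype.card κ := by
  rw [← nullity_one_sub_mul_inv_mul hD, nullity_eq_card_iff, sub_eq_zero, eq_comm]

end Nullity

section KernelFrame

variable {ι κ 𝕜 : Type*} [Fintype ι] [DecidableEq κ] [RCLike 𝕜] {A B : Matrix ι ι 𝕜}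
  {V : Matrix ι κ 𝕜}

/-- The columns of `V` are an orthonormal basis of the kernel of `A`. -/
structure IsKernelFrame (A : Matrix ι ι 𝕜) (V : Matrix ι κ 𝕜) : Prop where
  mul_eq_zero : A * V = 0
  orthonormal : Vᴴ * V = 1
  eq_zero : ∀ x, A *ᵥ x = 0 → Vᴴ *ᵥ x = 0 → x = 0

theorem IsKernelFrame.conjTranspose_mul (hV : IsKernelFrame A V) (hA : Aᴴ = -A) : Vᴴ * A = 0 := by
  rw [← neg_neg A, ← hA, Matrix.mul_neg, ← Matrix.conjTranspose_mul, hV.mul_eq_zero,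
    Matrix.conjTranspose_zero, neg_zero]

variable [Fintype κ]

theorem exists_isKernelFrame (h : nullity A = Fintype.card κ) :
    ∃ V : Matrix ι κ 𝕜, IsKernelFrame A V := by
  let e : EuclideanSpace 𝕜 ι ≃ₗ[𝕜] (ι → 𝕜) := WithLp.linearEquiv 2 𝕜 (ι → 𝕜)
  let S : Submodule 𝕜 (EuclideanSpace 𝕜 ι) := (LinearMap.ker A.mulVecLin).map e.symm.toLinearMap
  have hmem {x : EuclideanSpace 𝕜 ι} : x ∈ S ↔ A *ᵥ e x = 0 := Submodule.mem_map_equiv _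
  have hS : finrank 𝕜 S = Fintype.card κ := (e.symm.finrank_map_eq _).trans h
  let b : OrthonormalBasis κ 𝕜 S :=
    (stdOrthonormalBasis 𝕜 S).reindex ((finCongr hS).trans (Fintype.equivFin κ).symm)
  have hinner (j : κ) (x : EuclideanSpace 𝕜 ι) :
      inner 𝕜 (b j : EuclideanSpace 𝕜 ι) x = star (e (b j)) ⬝ᵥ e x := by
    rw [EuclideanSpace.inner_eq_star_dotProduct, dotProduct_comm]
    rfl
  refine ⟨Matrix.of fun i j ↦ e (b j) i, ?_, ?_, fun x hx hVx ↦ ?_⟩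
  · ext i j
    exact congrFun (hmem.1 (b j).2) i
  · ext j k
    rw [Matrix.one_apply, ← orthonormal_iff_ite.1 b.orthonormal j k, Submodule.coe_inner, hinner]
    rfl
  · have hxS : e.symm x ∈ S := hmem.2 (by rwa [e.apply_symm_apply])
    have hzero : (⟨e.symm x, hxS⟩ : S) = 0 := by
      refine b.toBasis.ext_elem fun j ↦ ?_
      rw [OrthonormalBasis.coe_toBasis_repr_apply, OrthonormalBasis.repr_apply_apply,
        Submodule.coe_inner, hinner, e.apply_symm_apply, map_zero]
      exact congrFun hVx j
    exact e.symm.map_eq_zero_iff.1 (congrArg Subtype.val hzero)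

variable [DecidableEq ι]

theorem IsKernelFrame.isUnit_add (hV : IsKernelFrame A V) (hA : Aᴴ = -A) :
    IsUnit (A + V * Vᴴ) := by
  rw [← Matrix.mulVec_injective_iff_isUnit]
  refine (injective_iff_map_eq_zero (A + V * Vᴴ).mulVecLin).2 fun x hx ↦ ?_
  rw [Matrix.mulVecLin_apply] at hx
  have hVx : Vᴴ *ᵥ x = 0 := by
    calc Vᴴ *ᵥ x = (Vᴴ * (A + V * Vᴴ)) *ᵥ x := by
          rw [Matrix.mul_add, hV.conjTranspose_mul hA, zero_add, ← Matrix.mul_assoc,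
            hV.orthonormal, Matrix.one_mul]
      _ = 0 := by rw [← Matrix.mulVec_mulVec, hx, Matrix.mulVec_zero]
  refine hV.eq_zero x ?_ hVx
  rwa [Matrix.add_mulVec, ← Matrix.mulVec_mulVec, hVx, Matrix.mulVec_zero, add_zero] at hx

theorem IsKernelFrame.inv_add_mul (hV : IsKernelFrame A V) (hA : Aᴴ = -A) :
    (A + V * Vᴴ)⁻¹ * V = V := by
  have hdet := (Matrix.isUnit_iff_isUnit_det _).1 (hV.isUnit_add hA)
  have hDV : (A + V * Vᴴ) * V = V := by
    rw [Matrix.add_mul, hV.mul_eq_zero, zero_add, Matrix.mul_assoc, hV.orthonormal, Matrix.mul_one]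
  simpa only [hDV] using Matrix.nonsing_inv_mul_cancel_left (A + V * Vᴴ) V hdet

theorem IsKernelFrame.conjTranspose_mul_inv_add (hV : IsKernelFrame A V) (hA : Aᴴ = -A) :
    Vᴴ * (A + V * Vᴴ)⁻¹ = Vᴴ := by
  have hdet := (Matrix.isUnit_iff_isUnit_det _).1 (hV.isUnit_add hA)
  have hVD : Vᴴ * (A + V * Vᴴ) = Vᴴ := by
    rw [Matrix.mul_add, hV.conjTranspose_mul hA, zero_add, ← Matrix.mul_assoc, hV.orthonormal,
      Matrix.one_mul]
  simpa only [hVD] using Matrix.mul_nonsing_inv_cancel_right (A + V * Vᴴ) Vᴴ hdet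

/-- The inverse of the regularization `B + V Vᴴ` of `B`, compressed to the span of the columns of
`V`. It detects the nullity of `B`, see `compressedInverse_eq_one_iff`. -/
noncomputable def compressedInverse (V : Matrix ι κ 𝕜) (B : Matrix ι ι 𝕜) : Matrix κ κ 𝕜 :=
  Vᴴ * (B + V * Vᴴ)⁻¹ * V

theorem compressedInverse_eq_one_iff (hD : IsUnit (B + V * Vᴴ)) :
    compressedInverse V B = 1 ↔ nullity B = Fintype.card κ :=
  mul_inv_mul_eq_one_iff_nullity_eq hD

theorem IsKernelFrame.compressedInverse_eq_one (hV : IsKernelFrame A V) (hA : Aᴴ = -A) :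
    compressedInverse V A = 1 := by
  rw [compressedInverse, hV.conjTranspose_mul_inv_add hA, hV.orthonormal]

omit [DecidableEq κ] in
theorem compressedInverse_add_conjTranspose (hB : Bᴴ = -B) (hD : IsUnit (B + V * Vᴴ)) :
    compressedInverse V B + (compressedInverse V B)ᴴ =
      (2 : ℝ) • ((compressedInverse V B)ᴴ * compressedInverse V B) := by
  set D := B + V * Vᴴ with hD_def
  have hDH : Dᴴ = -B + V * Vᴴ := by
    rw [hD_def, Matrix.conjTranspose_add, hB, Matrix.conjTranspose_mul,
      Matrix.conjTranspose_conjTranspose]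
  have hdet := (Matrix.isUnit_iff_isUnit_det D).1 hD
  have hdetH : IsUnit Dᴴ.det := by rw [Matrix.det_conjTranspose]; exact hdet.star
  have hW : (compressedInverse V B)ᴴ = Vᴴ * Dᴴ⁻¹ * V := by
    simp only [compressedInverse, Matrix.conjTranspose_mul, Matrix.conjTranspose_nonsing_inv,
      Matrix.conjTranspose_conjTranspose, Matrix.mul_assoc, hD_def]
  have hsum : D⁻¹ + Dᴴ⁻¹ = Dᴴ⁻¹ * ((2 : ℝ) • (V * Vᴴ)) * D⁻¹ := by
    have h2 : (2 : ℝ) • (V * Vᴴ) = D + Dᴴ := by rw [hDH, hD_def, two_smul]; abel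
    rw [h2, Matrix.mul_add, Matrix.add_mul, Matrix.mul_nonsing_inv_cancel_right _ _ hdet,
      Matrix.nonsing_inv_mul _ hdetH, Matrix.one_mul, add_comm]
  calc compressedInverse V B + (compressedInverse V B)ᴴ = Vᴴ * (D⁻¹ + Dᴴ⁻¹) * V := by
        rw [hW, compressedInverse, Matrix.mul_add, Matrix.add_mul]
    _ = (2 : ℝ) • ((compressedInverse V B)ᴴ * compressedInverse V B) := by
        rw [hsum, hW, compressedInverse]
        simp only [Matrix.mul_assoc, Matrix.mul_smul, Matrix.smul_mul, hD_def]

/-- A skew-Hermitian matrix that vanishes exactly when `B` has nullity `card κ`, for skew-Hermitian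
`B` near a matrix with kernel frame `V`. Its derivative there is the compression
`H ↦ Vᴴ H V`, which is why the sign is reversed. -/
noncomputable def nullityObstruction (V : Matrix ι κ 𝕜) (B : Matrix ι ι 𝕜) :
    skewAdjoint (Matrix κ κ 𝕜) :=
  -skewAdjointPart ℝ (compressedInverse V B)

theorem nullityObstruction_eq_zero_iff (hB : Bᴴ = -B) (hD : IsUnit (B + V * Vᴴ))
    (hW : IsUnit (compressedInverse V B)) :
    nullityObstruction V B = 0 ↔ nullity B = Fintype.card κ := by
  rw [← compressedInverse_eq_one_iff hD, nullityObstruction, neg_eq_zero]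
  have hadd := compressedInverse_add_conjTranspose hB hD
  set W := compressedInverse V B
  constructor
  · intro h
    have hself : Wᴴ = W := by
      have h' := StarModule.selfAdjointPart_add_skewAdjointPart ℝ W
      rw [h, ZeroMemClass.coe_zero, add_zero] at h'
      rw [← h']
      exact (selfAdjointPart ℝ W).2
    rw [hself, ← two_smul ℝ] at hadd
    have hidem : W * 1 = W * W := by
      rw [mul_one]
      exact smul_right_injective _ (two_ne_zero' ℝ) hadd
    exact (hW.mul_left_cancel hidem).symm
  · intro h
    rw [h]
    exact IsSelfAdjoint.skewAdjointPart_apply ℝ (.one _)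

section Calculus

attribute [local instance] Matrix.linftyOpNormedRing Matrix.linftyOpNormedAlgebra

variable {E G : Type*} [NormedAddCommGroup E] [NormedSpace ℝ E] [FiniteDimensional ℝ E]
  [NormedAddCommGroup G] [NormedSpace ℝ G] (a : E →ₗ[ℝ] Matrix ι ι 𝕜) {x : E}

theorem eventually_isUnit_add {C : Matrix ι ι 𝕜} (h : IsUnit (a x + C)) :
    ∀ᶠ y in 𝓝 x, IsUnit (a y + C) := by
  have : CompleteSpace (Matrix ι ι 𝕜) := FiniteDimensional.complete ℝ _
  have hcont : Continuous fun y ↦ a y + C :=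
    a.toContinuousLinearMap.continuous.add continuous_const
  exact hcont.continuousAt.eventually_mem (Units.isOpen.mem_nhds h)

theorem contDiffAt_map_inv_add (P : Matrix ι ι 𝕜 →ₗ[ℝ] G) {C : Matrix ι ι 𝕜}
    (h : IsUnit (a x + C)) : ContDiffAt ℝ ω (fun y ↦ P (a y + C)⁻¹) x := by
  have : CompleteSpace (Matrix ι ι 𝕜) := FiniteDimensional.complete ℝ _
  simp only [Matrix.nonsing_inv_eq_ringInverse]
  obtain ⟨u, hu⟩ := h
  have hinv : ContDiffAt ℝ ω Ring.inverse (a x + C) := hu ▸ contDiffAt_ringInverse ℝ u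
  exact P.toContinuousLinearMap.contDiff.contDiffAt.comp x
    (hinv.comp x (a.toContinuousLinearMap.contDiff.contDiffAt.add contDiffAt_const))

theorem fderiv_map_inv_add_apply (P : Matrix ι ι 𝕜 →ₗ[ℝ] G) {C : Matrix ι ι 𝕜}
    (h : IsUnit (a x + C)) (y : E) :
    fderiv ℝ (fun y ↦ P (a y + C)⁻¹) x y = -P ((a x + C)⁻¹ * a y * (a x + C)⁻¹) := by
  have : CompleteSpace (Matrix ι ι 𝕜) := FiniteDimensional.complete ℝ _
  simp only [Matrix.nonsing_inv_eq_ringInverse]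
  obtain ⟨u, hu⟩ := h
  have hinv := hasFDerivAt_ringInverse (𝕜 := ℝ) u
  rw [hu] at hinv
  have hd := P.toContinuousLinearMap.hasFDerivAt.comp x
    (hinv.comp x (a.toContinuousLinearMap.hasFDerivAt.add_const C))
  rw [← map_neg, ← hu, Ring.inverse_unit]
  exact congrArg (· y) hd.fderiv

/-- The map `X ↦ Vᴴ X V`, as a real linear map. -/
noncomputable def compression (V : Matrix ι κ 𝕜) : Matrix ι ι 𝕜 →ₗ[ℝ] Matrix κ κ 𝕜 where
  toFun X := Vᴴ * X * V
  map_add' X Y := by rw [Matrix.mul_add, Matrix.add_mul]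
  map_smul' r X := by rw [Matrix.mul_smul, Matrix.smul_mul, RingHom.id_apply]

namespace IsKernelFrame

variable {a}

theorem eventually_nullity_eq_iff (hV : IsKernelFrame (a x) V) (ha : ∀ y, (a y)ᴴ = -a y) :
    ∀ᶠ y in 𝓝 x, nullityObstruction V (a y) = 0 ↔ nullity (a y) = Fintype.card κ := by
  have : CompleteSpace (Matrix κ κ 𝕜) := FiniteDimensional.complete ℝ _
  have hD := hV.isUnit_add (ha x)
  have hcont : ContinuousAt (fun y ↦ compressedInverse V (a y)) x :=
    (contDiffAt_map_inv_add a (compression V) hD).continuousAt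
  have hW : ∀ᶠ y in 𝓝 x, IsUnit (compressedInverse V (a y)) :=
    hcont.eventually_mem (Units.isOpen.mem_nhds (hV.compressedInverse_eq_one (ha x) ▸ isUnit_one))
  filter_upwards [eventually_isUnit_add a hD, hW] with y hDy hWy
  exact nullityObstruction_eq_zero_iff (ha y) hDy hWy

variable (Λ : skewAdjoint (Matrix κ κ 𝕜) →ₗ[ℝ] G)

theorem contDiffAt_nullityObstruction (hV : IsKernelFrame (a x) V) (ha : (a x)ᴴ = -a x) :
    ContDiffAt ℝ ω (fun y ↦ Λ (nullityObstruction V (a y))) x :=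
  contDiffAt_map_inv_add a (Λ ∘ₗ (-skewAdjointPart ℝ) ∘ₗ compression V) (hV.isUnit_add ha)

theorem fderiv_nullityObstruction_apply (hV : IsKernelFrame (a x) V) (ha : (a x)ᴴ = -a x)
    (y : E) :
    fderiv ℝ (fun y ↦ Λ (nullityObstruction V (a y))) x y =
      Λ (skewAdjointPart ℝ (Vᴴ * a y * V)) := by
  refine (fderiv_map_inv_add_apply a (Λ ∘ₗ (-skewAdjointPart ℝ) ∘ₗ compression V)
    (hV.isUnit_add ha) y).trans ?_
  have hcomp : compression V ((a x + V * Vᴴ)⁻¹ * a y * (a x + V * Vᴴ)⁻¹) = Vᴴ * a y * V := by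
    calc Vᴴ * ((a x + V * Vᴴ)⁻¹ * a y * (a x + V * Vᴴ)⁻¹) * V
        = Vᴴ * (a x + V * Vᴴ)⁻¹ * a y * ((a x + V * Vᴴ)⁻¹ * V) := by simp only [Matrix.mul_assoc]
      _ = Vᴴ * a y * V := by rw [hV.conjTranspose_mul_inv_add ha, hV.inv_add_mul ha]
  simp only [LinearMap.comp_apply, hcomp, LinearMap.neg_apply, map_neg, neg_neg]

end IsKernelFrame

end Calculus

end KernelFrame

section SkewAdjoint

theorem skewAdjointPart_coe {A : Type*} [AddCommGroup A] [Module ℝ A] [StarAddMonoid A]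
    [StarModule ℝ A] (S : skewAdjoint A) : skewAdjointPart ℝ (S : A) = S :=
  LinearMap.congr_fun (skewAdjointPart_comp_subtype_skewAdjoint ℝ) S

instance finite_skewAdjoint {A : Type*} [AddCommGroup A] [Module ℝ A] [StarAddMonoid A]
    [StarModule ℝ A] [Module.Finite ℝ A] : Module.Finite ℝ (skewAdjoint A) :=
  .of_surjective (skewAdjointPart ℝ) fun S ↦ ⟨S, skewAdjointPart_coe S⟩

theorem finrank_skewAdjoint_add_finrank_selfAdjoint {A : Type*} [AddCommGroup A] [Module ℝ A]
    [StarAddMonoid A] [StarModule ℝ A] [Module.Finite ℝ A] :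
    finrank ℝ (skewAdjoint A) + finrank ℝ (selfAdjoint A) = finrank ℝ A := by
  have : Module.Finite ℝ (selfAdjoint A) := .of_surjective (selfAdjointPart ℝ) fun S ↦
    ⟨S, LinearMap.congr_fun (selfAdjointPart_comp_subtype_selfAdjoint ℝ) S⟩
  rw [(StarModule.decomposeProdAdjoint ℝ A).finrank_eq, finrank_prod, add_comm]

theorem two_mul_finrank_skewAdjoint {A : Type*} [AddCommGroup A] [Module ℂ A] [StarAddMonoid A]
    [StarModule ℂ A] [Module.Finite ℝ A] : 2 * finrank ℝ (skewAdjoint A) = finrank ℝ A := by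
  have hbij : Function.Bijective (skewAdjoint.negISMul (A := A)) := by
    refine ⟨fun S T h ↦ Subtype.ext ?_, fun S ↦ ⟨⟨Complex.I • (S : A), ?_⟩, Subtype.ext ?_⟩⟩
    · rw [← skewAdjoint.I_smul_neg_I S, h, skewAdjoint.I_smul_neg_I]
    · rw [skewAdjoint.mem_iff, star_smul, selfAdjoint.mem_iff.1 S.2, Complex.star_def,
        Complex.conj_I, neg_smul]
    · simp [skewAdjoint.negISMul, smul_smul]
  rw [← finrank_skewAdjoint_add_finrank_selfAdjoint (A := A),
    ← (LinearEquiv.ofBijective _ hbij).finrank_eq, two_mul]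

theorem finrank_skewAdjoint_matrix_complex {κ : Type*} [Fintype κ] :
    finrank ℝ (skewAdjoint (Matrix κ κ ℂ)) = Fintype.card κ * Fintype.card κ := by
  have h := two_mul_finrank_skewAdjoint (A := Matrix κ κ ℂ)
  rw [finrank_matrix, Complex.finrank_real_complex] at h
  lia

theorem skewAdjoint_matrix_real_apply {κ : Type*} (S : skewAdjoint (Matrix κ κ ℝ)) (i j : κ) :
    (S : Matrix κ κ ℝ) i j = -(S : Matrix κ κ ℝ) j i := by
  have h : star (S : Matrix κ κ ℝ) = -S := skewAdjoint.mem_iff.1 S.2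
  exact congrFun (congrFun h j) i

/-- A real skew-symmetric matrix is determined by its entries above the diagonal. -/
def skewAdjointEquivUpper (κ : Type*) [LinearOrder κ] :
    skewAdjoint (Matrix κ κ ℝ) ≃ₗ[ℝ] ({p : κ × κ // p.1 < p.2} → ℝ) where
  toFun S p := (S : Matrix κ κ ℝ) p.1.1 p.1.2
  map_add' _ _ := rfl
  map_smul' _ _ := rfl
  invFun f := ⟨.of fun i j ↦ if h : i < j then f ⟨(i, j), h⟩ else
    if h : j < i then -f ⟨(j, i), h⟩ else 0, by
      rw [skewAdjoint.mem_iff]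
      ext i j
      rcases lt_trichotomy i j with h | rfl | h
      · simp [Matrix.star_apply, h, h.not_gt]
      · simp [Matrix.star_apply]
      · simp [Matrix.star_apply, h, h.not_gt]⟩
  left_inv S := by
    ext i j
    have := skewAdjoint_matrix_real_apply S
    rcases lt_trichotomy i j with h | rfl | h
    · simp [h]
    · simpa using (self_eq_neg.1 (this i i)).symm
    · simp [h, h.not_gt, this i j]
  right_inv f := by
    ext p
    simp [p.2]

theorem finrank_skewAdjoint_matrix_real {κ : Type*} [Fintype κ] :
    finrank ℝ (skewAdjoint (Matrix κ κ ℝ)) = (Fintype.card κ).choose 2 := by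
  let : LinearOrder κ := LinearOrder.lift' (Fintype.equivFin κ) (Fintype.equivFin κ).injective
  rw [(skewAdjointEquivUpper κ).finrank_eq, finrank_fintype_fun_eq_card, Fintype.card_subtype]
  exact Fintype.card_product_filter_lt

end SkewAdjoint

section Spectrum

open Polynomial

variable {ι : Type*} [Fintype ι] [DecidableEq ι]

theorem finrank_eigenspace_toLin' {F : Type*} [Field F] (A : Matrix ι ι F) (z : F) :
    finrank F (Module.End.eigenspace (Matrix.toLin' A) z) = nullity (A - z • 1) := by
  rw [nullity, Module.End.eigenspace_def, ← Matrix.toLin'_apply', map_sub, map_smul,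
    Matrix.toLin'_one]
  rfl

section Normal

variable {𝕜 : Type*} [RCLike 𝕜]

omit [DecidableEq ι] in
theorem conjTranspose_mulVec_eq_zero_iff_of_isStarNormal {B : Matrix ι ι 𝕜} (hB : IsStarNormal B)
    (x : ι → 𝕜) : Bᴴ *ᵥ x = 0 ↔ B *ᵥ x = 0 := by
  have hcomm : Bᴴ * B = B * Bᴴ := hB.star_comm_self
  rw [← Matrix.self_mul_conjTranspose_mulVec_eq_zero, ← hcomm,
    Matrix.conjTranspose_mul_self_mulVec_eq_zero]

theorem ker_toLin'_pow_of_isStarNormal {B : Matrix ι ι 𝕜} (hB : IsStarNormal B) {k : ℕ}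
    (hk : k ≠ 0) : LinearMap.ker (Matrix.toLin' B ^ k) = LinearMap.ker (Matrix.toLin' B) := by
  have hsq : LinearMap.ker (Matrix.toLin' B ^ 1) = LinearMap.ker (Matrix.toLin' B ^ 2) := by
    ext x
    simp only [pow_one, pow_two, LinearMap.mem_ker, Module.End.mul_apply, Matrix.toLin'_apply]
    rw [← conjTranspose_mulVec_eq_zero_iff_of_isStarNormal hB (B *ᵥ x), Matrix.mulVec_mulVec,
      Matrix.conjTranspose_mul_self_mulVec_eq_zero]
  obtain ⟨m, rfl⟩ := Nat.exists_eq_add_of_le (Nat.one_le_iff_ne_zero.2 hk)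
  rw [← Module.End.ker_pow_constant hsq m, pow_one]

theorem nullity_sub_smul_one_eq_rootMultiplicity {A : Matrix ι ι 𝕜} (hA : IsStarNormal A) (z : 𝕜) :
    nullity (A - z • 1) = A.charpoly.rootMultiplicity z := by
  have hB : IsStarNormal (A - z • 1) := Commute.isStarNormal_sub <| by
    rw [star_smul, star_one]
    exact (Commute.one_right A).smul_right (star z)
  have hsub : Matrix.toLin' A - z • 1 = Matrix.toLin' (A - z • 1) := by
    rw [map_sub, map_smul, Matrix.toLin'_one]
    rfl
  rw [nullity, ← Matrix.toLin'_apply', ← Matrix.charpoly_toLin',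
    ← LinearMap.finrank_maxGenEigenspace_eq]
  suffices LinearMap.ker (Matrix.toLin' (A - z • 1)) =
      Module.End.maxGenEigenspace (Matrix.toLin' A) z by rw [this]
  ext x
  rw [Module.End.mem_maxGenEigenspace, hsub]
  refine ⟨fun hx ↦ ⟨1, by rwa [pow_one]⟩, fun ⟨k, hk⟩ ↦ ?_⟩
  rw [← ker_toLin'_pow_of_isStarNormal hB k.succ_ne_zero, LinearMap.mem_ker, pow_succ',
    Module.End.mul_apply, hk, map_zero]

theorem star_eq_neg_of_isRoot_charpoly {A : Matrix ι ι 𝕜} (hA : Aᴴ = -A) {z : 𝕜}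
    (hz : A.charpoly.IsRoot z) : star z = -z := by
  rw [← Matrix.charpoly_toLin', ← Module.End.hasEigenvalue_iff_isRoot_charpoly] at hz
  obtain ⟨v, hv⟩ := hz.exists_hasEigenvector
  have hAv : A *ᵥ v = z • v := hv.apply_eq_smul
  have hvA : star v ᵥ* A = -(star z • star v) := by
    rw [← star_smul, ← hAv, Matrix.star_mulVec, hA, Matrix.vecMul_neg, neg_neg]
  have hne : star v ⬝ᵥ v ≠ 0 := fun h ↦ hv.2 (dotProduct_star_self_eq_zero.1 h)
  have h := Matrix.dotProduct_mulVec (star v) A v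
  rw [hAv, hvA, dotProduct_smul, neg_dotProduct, smul_dotProduct, smul_eq_mul, smul_eq_mul,
    ← neg_mul] at h
  exact (neg_eq_iff_eq_neg.2 (mul_right_cancel₀ hne h)).symm

end Normal

section SkewSymmetric

theorem charpoly_neg {R : Type*} [CommRing R] (A : Matrix ι ι R) :
    (-A).charpoly = (-1) ^ Fintype.card ι * A.charpoly.comp (-X) := by
  have h : (-A).charmatrix = -(compRingHom (-X)).mapMatrix A.charmatrix := by
    ext1 i j
    by_cases hij : i = j
    · subst hij
      simp
      ring
    · simp [hij]
  rw [Matrix.charpoly, h, Matrix.det_neg, ← RingHom.map_det]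
  rfl

theorem charpoly_eq_of_transpose_eq_neg {R : Type*} [CommRing R] {A : Matrix ι ι R}
    (hA : Aᵀ = -A) : A.charpoly = (-1) ^ Fintype.card ι * A.charpoly.comp (-X) := by
  rw [← charpoly_neg, ← hA, Matrix.charpoly_transpose]

variable {F : Type*} [Field F] {A : Matrix ι ι F}

theorem even_rootMultiplicity_zero_iff_of_transpose_eq_neg (hF : (-1 : F) ≠ 1) (hA : Aᵀ = -A) :
    Even (A.charpoly.rootMultiplicity 0) ↔ Even (Fintype.card ι) := by
  rw [rootMultiplicity_eq_natTrailingDegree']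
  set k := A.charpoly.natTrailingDegree
  have hk : A.charpoly.coeff k ≠ 0 := trailingCoeff_nonzero_iff_nonzero.2 A.charpoly_monic.ne_zero
  have h := congrArg (coeff · k) (charpoly_eq_of_transpose_eq_neg hA)
  have hX : (-X : F[X]) = C (-1) * X := by simp
  have hC : ((-1) ^ Fintype.card ι : F[X]) = C ((-1) ^ Fintype.card ι) := by simp
  simp only [hX, hC, coeff_C_mul, comp_C_mul_X_coeff] at h
  have hsign : (-1 : F) ^ (k + Fintype.card ι) = 1 := by
    refine mul_left_cancel₀ hk ?_
    linear_combination -h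
  rw [← Nat.even_add, ← neg_one_pow_eq_one_iff_even hF, hsign]

theorem rootMultiplicity_neg_of_transpose_eq_neg (hA : Aᵀ = -A) (z : F) :
    A.charpoly.rootMultiplicity (-z) = A.charpoly.rootMultiplicity z := by
  classical
  have h : A.charpoly.roots = A.charpoly.roots.map fun x ↦ -x := by
    have hC : ((-1) ^ Fintype.card ι : F[X]) = C ((-1) ^ Fintype.card ι) := by simp
    rw [← roots_comp_neg_X]
    nth_rw 1 [charpoly_eq_of_transpose_eq_neg hA]
    rw [hC, roots_C_mul _ (pow_ne_zero _ (neg_ne_zero.2 one_ne_zero))]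
  rw [← count_roots, ← count_roots, h, Multiset.count_map_eq_count' _ _ neg_injective, ← h]

theorem two_mul_rootMultiplicity_le_of_transpose_eq_neg (hF : (-1 : F) ≠ 1) (hA : Aᵀ = -A) {z : F}
    (hz : z ≠ 0) : 2 * A.charpoly.rootMultiplicity z ≤ Fintype.card ι := by
  classical
  have hne : z ≠ -z := fun h ↦ hz (by grind)
  calc 2 * A.charpoly.rootMultiplicity z
    _ = ∑ x ∈ {z, -z}, A.charpoly.roots.count x := by
      rw [Finset.sum_pair hne, count_roots, count_roots,
        rootMultiplicity_neg_of_transpose_eq_neg hA, two_mul]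
    _ ≤ ∑ x ∈ {z, -z} ∪ A.charpoly.roots.toFinset, A.charpoly.roots.count x :=
      Finset.sum_le_sum_of_subset Finset.subset_union_left
    _ = A.charpoly.roots.card := Multiset.sum_count_eq_card fun x hx ↦
      Finset.mem_union_right _ (Multiset.mem_toFinset.2 hx)
    _ ≤ Fintype.card ι := A.charpoly_natDegree_eq_dim ▸ card_roots' _

end SkewSymmetric

end Spectrum

section SkewSymm

variable {n : ℕ}

theorem conjTranspose_complexify (K : skewSymm n) :
    (complexify (K : Matrix (Fin n) (Fin n) ℝ))ᴴ = -complexify (K : Matrix (Fin n) (Fin n) ℝ) := by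
  have h : (K : Matrix (Fin n) (Fin n) ℝ)ᵀ = -K := K.2
  ext i j
  simpa [complexify] using congrArg ((↑) : ℝ → ℂ) (congrFun (congrFun h i) j)

theorem transpose_complexify (K : skewSymm n) :
    (complexify (K : Matrix (Fin n) (Fin n) ℝ))ᵀ = -complexify (K : Matrix (Fin n) (Fin n) ℝ) := by
  rw [complexify, ← Matrix.transpose_map, K.2]
  ext i j
  simp

theorem charpoly_complexify (K : Matrix (Fin n) (Fin n) ℝ) :
    (complexify K).charpoly = K.charpoly.map (algebraMap ℝ ℂ) :=
  Matrix.charpoly_map K (algebraMap ℝ ℂ)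

theorem isRepeatedEigenvalue_iff_two_le_nullity (K : skewSymm n) (z : ℂ) :
    IsRepeatedEigenvalue (K : Matrix (Fin n) (Fin n) ℝ) z ↔
      2 ≤ nullity (complexify (K : Matrix (Fin n) (Fin n) ℝ) - z • 1) := by
  rw [nullity_sub_smul_one_eq_rootMultiplicity
    (skewAdjoint.isStarNormal_of_mem (conjTranspose_complexify K)), IsRepeatedEigenvalue]

theorem IsRepeatedEigenvalue.eq_im_mul_I {K : skewSymm n} {z : ℂ}
    (h : IsRepeatedEigenvalue (K : Matrix (Fin n) (Fin n) ℝ) z) : z = z.im * Complex.I := by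
  have hroot := (Polynomial.rootMultiplicity_pos (Matrix.charpoly_monic _).ne_zero).1
    (two_pos.trans_le h)
  have hz := congrArg Complex.re (star_eq_neg_of_isRoot_charpoly (conjTranspose_complexify K) hroot)
  rw [Complex.star_def, Complex.conj_re, Complex.neg_re] at hz
  rw [← Complex.re_add_im z, self_eq_neg.1 hz]
  simp

theorem derogatorySkew_eq_union (n : ℕ) :
    derogatorySkew n = repeatedZeroSkew n ∪ repeatedNonzeroSkew n := by
  ext K
  have h : K ∈ derogatorySkew n ↔ ∃ z, IsRepeatedEigenvalue (K : Matrix (Fin n) (Fin n) ℝ) z :=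
    exists_congr fun z ↦ by
      rw [isRepeatedEigenvalue_iff_two_le_nullity, finrank_eigenspace_toLin']
  rw [h]
  refine ⟨fun ⟨z, hz⟩ ↦ ?_, ?_⟩
  · rcases eq_or_ne z 0 with rfl | hz0
    exacts [.inl hz, .inr ⟨z, hz0, hz⟩]
  · rintro (hz | ⟨z, -, hz⟩)
    exacts [⟨0, hz⟩, ⟨z, hz⟩]

theorem nullity_eq_rootMultiplicity_zero (K : skewSymm n) :
    nullity (K : Matrix (Fin n) (Fin n) ℝ) =
      (K : Matrix (Fin n) (Fin n) ℝ).charpoly.rootMultiplicity 0 := by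
  have hK : (K : Matrix (Fin n) (Fin n) ℝ) ∈ skewAdjoint (Matrix (Fin n) (Fin n) ℝ) := K.2
  rw [← nullity_sub_smul_one_eq_rootMultiplicity (skewAdjoint.isStarNormal_of_mem hK), zero_smul,
    sub_zero]

theorem even_nullity_iff (K : skewSymm n) :
    Even (nullity (K : Matrix (Fin n) (Fin n) ℝ)) ↔ Even n := by
  rw [nullity_eq_rootMultiplicity_zero,
    even_rootMultiplicity_zero_iff_of_transpose_eq_neg (by norm_num) K.2, Fintype.card_fin]

theorem repeatedZeroSkew_eq_two_le_nullity (n : ℕ) :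
    repeatedZeroSkew n = {K : skewSymm n | 2 ≤ nullity (K : Matrix (Fin n) (Fin n) ℝ)} := by
  ext K
  rw [Set.mem_ofPred_eq, nullity_eq_rootMultiplicity_zero,
    Polynomial.eq_rootMultiplicity_map (f := algebraMap ℝ ℂ) Complex.ofReal_injective,
    ← charpoly_complexify, map_zero]
  rfl

theorem repeatedZeroSkew_eq_three_le_nullity (hn : Odd n) :
    repeatedZeroSkew n = {K : skewSymm n | 3 ≤ nullity (K : Matrix (Fin n) (Fin n) ℝ)} := by
  rw [repeatedZeroSkew_eq_two_le_nullity]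
  ext K
  have hodd : Odd (nullity (K : Matrix (Fin n) (Fin n) ℝ)) := by
    rwa [← Nat.not_even_iff_odd, even_nullity_iff, Nat.not_even_iff_odd]
  obtain ⟨k, hk⟩ := hodd
  simp only [Set.mem_ofPred_eq]
  lia

theorem repeatedZeroSkew_eq_det_eq_zero (hn : Even n) :
    repeatedZeroSkew n = {K : skewSymm n | (K : Matrix (Fin n) (Fin n) ℝ).det = 0} := by
  rw [repeatedZeroSkew_eq_two_le_nullity]
  ext K
  have heven := (even_nullity_iff K).2 hn
  have hdet : (K : Matrix (Fin n) (Fin n) ℝ).det = 0 ↔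
      nullity (K : Matrix (Fin n) (Fin n) ℝ) ≠ 0 := by
    rw [nullity, Ne, Submodule.finrank_eq_zero, ← Matrix.toLin'_apply',
      Matrix.ker_toLin'_eq_bot_iff, ← Matrix.exists_mulVec_eq_zero_iff]
    grind
  rw [Set.mem_ofPred_eq, Set.mem_ofPred_eq, hdet]
  grind

theorem repeatedNonzeroSkew_eq_empty (hn : n ≤ 3) : repeatedNonzeroSkew n = ∅ := by
  refine Set.eq_empty_of_forall_notMem fun K ⟨z, hz, h⟩ ↦ ?_
  have hle := two_mul_rootMultiplicity_le_of_transpose_eq_neg (by norm_num)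
    (transpose_complexify K) hz
  rw [Fintype.card_fin] at hle
  rw [IsRepeatedEigenvalue] at h
  lia

/-- The linear family `(K, μ) ↦ K - μ i` of skew-Hermitian matrices. The eigenvalues of a
skew-symmetric matrix `K` are the numbers `μ i` for which it is singular. -/
noncomputable def skewPencil (n : ℕ) : skewSymm n × ℝ →ₗ[ℝ] Matrix (Fin n) (Fin n) ℂ where
  toFun p := complexify (p.1 : Matrix (Fin n) (Fin n) ℝ) - ((p.2 : ℂ) * Complex.I) • 1
  map_add' p q := by
    ext i j
    simp [complexify]
    ring
  map_smul' r p := by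
    ext i j
    simp [complexify]
    ring

theorem skewPencil_apply_zero_right (K : skewSymm n) :
    skewPencil n (K, 0) = complexify (K : Matrix (Fin n) (Fin n) ℝ) := by
  simp [skewPencil]

theorem skewPencil_apply_zero_left (μ : ℝ) :
    skewPencil n (0, μ) = -((μ : ℂ) * Complex.I) • 1 := by
  ext i j
  simp [skewPencil, complexify]

theorem conjTranspose_skewPencil (p : skewSymm n × ℝ) :
    (skewPencil n p)ᴴ = -skewPencil n p := by
  change (complexify _ - _)ᴴ = -(complexify _ - _)
  rw [Matrix.conjTranspose_sub, Matrix.conjTranspose_smul, conjTranspose_complexify]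
  simp [neg_add_eq_sub]

theorem mem_repeatedNonzeroSkew_iff (K : skewSymm n) :
    K ∈ repeatedNonzeroSkew n ↔ ∃ μ : ℝ, μ ≠ 0 ∧ 2 ≤ nullity (skewPencil n (K, μ)) := by
  refine ⟨fun ⟨z, hz, h⟩ ↦ ⟨z.im, fun h0 ↦ hz ?_, ?_⟩, fun ⟨μ, hμ, h⟩ ↦
    ⟨μ * Complex.I, by simpa using hμ, (isRepeatedEigenvalue_iff_two_le_nullity K _).2 h⟩⟩
  · rw [h.eq_im_mul_I, h0, Complex.ofReal_zero, zero_mul]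
  · rw [h.eq_im_mul_I] at h
    exact (isRepeatedEigenvalue_iff_two_le_nullity K _).1 h

end SkewSymm

section Strata

theorem transpose_mul_self_eq_zero_of_mul_eq_smul {ι κ F : Type*} [Fintype ι] [Field F]
    [NeZero (2 : F)] {A : Matrix ι ι F} (hA : Aᵀ = -A) {z : F} (hz : z ≠ 0) {V : Matrix ι κ F}
    (hV : A * V = z • V) : Vᵀ * V = 0 := by
  have hVA : Vᵀ * A = -(z • Vᵀ) := by
    rw [← neg_neg A, ← hA, Matrix.mul_neg, ← Matrix.transpose_mul, hV, Matrix.transpose_smul]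
  have h : z • (Vᵀ * V) = -(z • (Vᵀ * V)) :=
    calc z • (Vᵀ * V) = Vᵀ * (A * V) := by rw [hV, Matrix.mul_smul]
      _ = (Vᵀ * A) * V := (Matrix.mul_assoc _ _ _).symm
      _ = -(z • (Vᵀ * V)) := by rw [hVA, Matrix.neg_mul, Matrix.smul_mul]
  have h2 : (2 * z) • (Vᵀ * V) = 0 := by rw [mul_smul, two_smul, add_eq_zero_iff_eq_neg, ← h]
  exact (smul_eq_zero.1 h2).resolve_left (mul_ne_zero two_ne_zero hz)

variable {κ : Type*}

theorem compression_conjugate {ι R : Type*} [Fintype ι] [Fintype κ] [DecidableEq κ] [Semiring R]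
    [Star R] {V : Matrix ι κ R} (hV : Vᴴ * V = 1) (S : Matrix κ κ R) :
    Vᴴ * (V * S * Vᴴ) * V = S :=
  calc Vᴴ * (V * S * Vᴴ) * V = (Vᴴ * V) * S * (Vᴴ * V) := by simp only [Matrix.mul_assoc]
    _ = S := by rw [hV, Matrix.one_mul, Matrix.mul_one]

theorem conjTranspose_conjugate {ι R : Type*} [Fintype κ] [Ring R] [StarRing R] (V : Matrix ι κ R)
    {S : Matrix κ κ R} (hS : Sᴴ = -S) : (V * S * Vᴴ)ᴴ = -(V * S * Vᴴ) := by
  rw [Matrix.conjTranspose_mul, Matrix.conjTranspose_mul, hS, Matrix.conjTranspose_conjTranspose,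
    ← Matrix.mul_assoc, Matrix.mul_neg, Matrix.neg_mul]

theorem exists_skewSymm_real_compression_eq [Finite κ] [DecidableEq κ] {n : ℕ}
    {V : Matrix (Fin n) κ ℝ} (hV : Vᴴ * V = 1) (S : skewAdjoint (Matrix κ κ ℝ)) :
    ∃ X : skewSymm n, Vᴴ * (X : Matrix (Fin n) (Fin n) ℝ) * V = S :=
  have := Fintype.ofFinite κ
  ⟨⟨V * (S : Matrix κ κ ℝ) * Vᴴ, conjTranspose_conjugate V S.2⟩, compression_conjugate hV S⟩

theorem exists_skewSymm_complexify_compression_eq [Finite κ] [DecidableEq κ] {n : ℕ}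
    {V : Matrix (Fin n) κ ℂ} (hVV : Vᵀ * V = 0) (hV : Vᴴ * V = 1) (S : skewAdjoint (Matrix κ κ ℂ)) :
    ∃ X : skewSymm n, Vᴴ * complexify (X : Matrix (Fin n) (Fin n) ℝ) * V = S := by
  have := Fintype.ofFinite κ
  -- `X` is twice the real part of the lift `Z`; the conjugate of `Z` compresses to zero.
  set Z := V * (S : Matrix κ κ ℂ) * Vᴴ with hZ
  set X := Matrix.of fun i j ↦ 2 * (Z i j).re
  have hX : X ∈ skewSymm n := by
    ext i j
    have h := congrArg Complex.re (congrFun₂ (conjTranspose_conjugate V S.2) i j)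
    rw [← hZ, Matrix.conjTranspose_apply, Complex.star_def, Complex.conj_re] at h
    simp [X, h]
  have hXZ : complexify X = Z + Zᴴᵀ := by
    ext i j
    simp [complexify, X, Complex.add_conj]
  have hZ' : Vᴴ * Zᴴᵀ * V = 0 := by
    have h : Zᴴᵀ = Vᴴᵀ * (S : Matrix κ κ ℂ)ᴴᵀ * Vᵀ := by
      simp [hZ, Matrix.conjTranspose_mul, Matrix.transpose_mul, Matrix.mul_assoc]
    rw [h, Matrix.mul_assoc, Matrix.mul_assoc, hVV, Matrix.mul_zero, Matrix.mul_zero]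
  refine ⟨⟨X, hX⟩, ?_⟩
  rw [hXZ, Matrix.mul_add, Matrix.add_mul, hZ', add_zero, compression_conjugate hV]

theorem IsKernelFrame.exists_compression_skewPencil_eq [Finite κ] [DecidableEq κ] {n : ℕ}
    {p : skewSymm n × ℝ} {V : Matrix (Fin n) κ ℂ} (hV : IsKernelFrame (skewPencil n p) V)
    (hp : p.2 ≠ 0) (S : skewAdjoint (Matrix κ κ ℂ)) :
    ∃ X : skewSymm n, Vᴴ * skewPencil n (X, 0) * V = S := by
  have hVz : complexify (p.1 : Matrix (Fin n) (Fin n) ℝ) * V = (p.2 * Complex.I : ℂ) • V := by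
    have h : (complexify (p.1 : Matrix (Fin n) (Fin n) ℝ) - (p.2 * Complex.I : ℂ) • 1) * V = 0 :=
      hV.mul_eq_zero
    rwa [Matrix.sub_mul, Matrix.smul_mul, Matrix.one_mul, sub_eq_zero] at h
  have hVV := transpose_mul_self_eq_zero_of_mul_eq_smul (transpose_complexify p.1)
    (by simpa using hp) hVz
  simpa only [skewPencil_apply_zero_right] using
    exists_skewSymm_complexify_compression_eq hVV hV.orthonormal S

theorem injective_skewAdjointPart_compression_skewPencil [Finite κ] [DecidableEq κ]
    [Nonempty κ] {n : ℕ} {V : Matrix (Fin n) κ ℂ} (hV : Vᴴ * V = 1) :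
    Function.Injective fun μ : ℝ ↦ skewAdjointPart ℝ (Vᴴ * skewPencil n (0, μ) * V) := by
  have := Fintype.ofFinite κ
  have hmem (μ : ℝ) : -(μ * Complex.I) • (1 : Matrix κ κ ℂ) ∈ skewAdjoint (Matrix κ κ ℂ) := by
    simp [skewAdjoint.mem_iff]
  have hpart (μ : ℝ) : skewAdjointPart ℝ (Vᴴ * skewPencil n (0, μ) * V) = ⟨_, hmem μ⟩ := by
    rw [← skewAdjointPart_coe ⟨_, hmem μ⟩]
    simp [skewPencil_apply_zero_left, hV]
  intro μ ν h
  have h' := congrArg Subtype.val ((hpart μ).symm.trans (h.trans (hpart ν)))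
  simpa using smul_left_injective ℂ one_ne_zero h'

theorem isSubmanifoldOfCodim_nullity_eq (n m : ℕ) :
    IsSubmanifoldOfCodim {K : skewSymm n | nullity (K : Matrix (Fin n) (Fin n) ℝ) = m}
      (m.choose 2) := by
  let Λ := (finBasis ℝ (skewAdjoint (Matrix (Fin m) (Fin m) ℝ))).equivFun
  have hskew : ∀ K : skewSymm n, ((skewSymm n).subtype K)ᴴ = -(skewSymm n).subtype K := fun K ↦ K.2
  have hcodim : finrank ℝ (skewAdjoint (Matrix (Fin m) (Fin m) ℝ)) = m.choose 2 := by
    rw [finrank_skewAdjoint_matrix_real, Fintype.card_fin]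
  rw [← hcodim, ← finrank_fin_fun ℝ (n := finrank ℝ _)]
  refine isSubmanifoldOfCodim_of_eventually fun K hK ↦ ?_
  obtain ⟨V, hV⟩ := exists_isKernelFrame (κ := Fin m) (hK.trans (Fintype.card_fin m).symm)
  refine ⟨_, ⟨hV.contDiffAt_nullityObstruction (a := (skewSymm n).subtype) Λ.toLinearMap (hskew K),
    fun y ↦ ?_⟩, ?_⟩
  · obtain ⟨S, rfl⟩ := Λ.surjective y
    obtain ⟨X, hX⟩ := exists_skewSymm_real_compression_eq hV.orthonormal S
    refine ⟨X, ?_⟩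
    rw [hV.fderiv_nullityObstruction_apply Λ.toLinearMap (hskew K), Submodule.subtype_apply, hX]
    exact congrArg Λ (skewAdjointPart_coe S)
  · filter_upwards [hV.eventually_nullity_eq_iff hskew] with L hL
    rw [Fintype.card_fin] at hL
    rw [LinearEquiv.coe_coe, Λ.map_eq_zero_iff, hL]
    rfl

theorem codimAtLeast_le_nullity (n m : ℕ) :
    CodimAtLeast {K : skewSymm n | m ≤ nullity (K : Matrix (Fin n) (Fin n) ℝ)} (m.choose 2) := by
  have h : {K : skewSymm n | m ≤ nullity (K : Matrix (Fin n) (Fin n) ℝ)} =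
      ⋃ k : ℕ, {K : skewSymm n | nullity (K : Matrix (Fin n) (Fin n) ℝ) = m + k} := by
    ext K
    simp only [Set.mem_ofPred_eq, Set.mem_iUnion]
    exact le_iff_exists_add
  rw [h]
  exact .iUnion fun k ↦ (isSubmanifoldOfCodim_nullity_eq n (m + k)).codimAtLeast.mono
    (Nat.choose_le_choose 2 (Nat.le_add_right m k))

/-- The pairs `(K, μ)`, `μ ≠ 0`, for which `μ i` is an eigenvalue of `K` of multiplicity `m`. They
resolve the matrices with a repeated nonzero eigenvalue, which are singular where several such
eigenvalues occur. -/
def eigenpairs (n m : ℕ) : Set (skewSymm n × ℝ) :=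
  {p | p.2 ≠ 0 ∧ nullity (skewPencil n p) = m}

variable {n m : ℕ}

theorem image_fst_eigenpairs_subset (hm : 2 ≤ m) :
    Prod.fst '' eigenpairs n m ⊆ repeatedNonzeroSkew n := by
  rintro _ ⟨⟨K, μ⟩, ⟨hμ, h⟩, rfl⟩
  exact (mem_repeatedNonzeroSkew_iff K).2 ⟨μ, hμ, hm.trans_eq h.symm⟩

theorem repeatedNonzeroSkew_eq_iUnion (n : ℕ) :
    repeatedNonzeroSkew n = ⋃ k : ℕ, Prod.fst '' eigenpairs n (2 + k) := by
  refine Set.Subset.antisymm (fun K hK ↦ ?_)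
    (Set.iUnion_subset fun k ↦ image_fst_eigenpairs_subset (Nat.le_add_right 2 k))
  obtain ⟨μ, hμ, h⟩ := (mem_repeatedNonzeroSkew_iff K).1 hK
  obtain ⟨k, hk⟩ := Nat.exists_eq_add_of_le h
  exact Set.mem_iUnion.2 ⟨k, (K, μ), ⟨hμ, hk⟩, rfl⟩

theorem exists_isSubmanifoldOfCodim_image_fst_eigenpairs (hm : m ≠ 0) {p : skewSymm n × ℝ}
    (hp : p ∈ eigenpairs n m) :
    ∃ W ∈ 𝓝 p, IsSubmanifoldOfCodim (Prod.fst '' (eigenpairs n m ∩ W)) (m * m - 1) := by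
  let Λ := (finBasis ℝ (skewAdjoint (Matrix (Fin m) (Fin m) ℂ))).equivFun
  have hcodim : m * m - 1 =
      finrank ℝ (Fin (finrank ℝ (skewAdjoint (Matrix (Fin m) (Fin m) ℂ))) → ℝ) - finrank ℝ ℝ := by
    rw [finrank_fin_fun, finrank_skewAdjoint_matrix_complex, Fintype.card_fin, finrank_self]
  have hskew := conjTranspose_skewPencil (n := n)
  obtain ⟨V, hV⟩ := exists_isKernelFrame (κ := Fin m) (hp.2.trans (Fintype.card_fin m).symm)
  have hd := hV.fderiv_nullityObstruction_apply Λ.toLinearMap (hskew p)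
  have : @CompleteSpace (skewSymm n) PseudoMetricSpace.toUniformSpace :=
    FiniteDimensional.complete ℝ _
  rw [hcodim]
  refine exists_isSubmanifoldOfCodim_image_fst hp
    (hV.contDiffAt_nullityObstruction Λ.toLinearMap (hskew p)) ?_ (fun y ↦ ?_) ?_
  · filter_upwards [hV.eventually_nullity_eq_iff hskew,
      continuous_snd.continuousAt.eventually_ne hp.1] with q hq hq0
    simp [eigenpairs, hq, hq0]
  · obtain ⟨S, rfl⟩ := Λ.surjective y
    obtain ⟨X, hX⟩ := hV.exists_compression_skewPencil_eq hp.1 S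
    refine ⟨X, ?_⟩
    beta_reduce
    rw [hd, hX]
    exact congrArg Λ (skewAdjointPart_coe S)
  · have : Nonempty (Fin m) := Fin.pos_iff_nonempty.1 (Nat.pos_of_ne_zero hm)
    simp only [hd]
    exact Λ.injective.comp (injective_skewAdjointPart_compression_skewPencil hV.orthonormal)

theorem codimAtLeast_repeatedNonzeroSkew (n : ℕ) : CodimAtLeast (repeatedNonzeroSkew n) 3 := by
  have : SecondCountableTopology (skewSymm n) := secondCountable_of_proper
  rw [repeatedNonzeroSkew_eq_iUnion]
  refine .iUnion fun k ↦ .image_of_locally fun p hp ↦ ?_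
  obtain ⟨W, hW, hM⟩ := exists_isSubmanifoldOfCodim_image_fst_eigenpairs (by lia) hp
  exact ⟨W, hW, hM.codimAtLeast.mono (Nat.le_sub_of_add_le (by nlinarith))⟩

end Strata

section Rotations

open Polynomial

theorem charpoly_blockDiagonal {o ι R : Type*} [Fintype o] [DecidableEq o] [Fintype ι]
    [DecidableEq ι] [CommRing R] (M : o → Matrix ι ι R) :
    (Matrix.blockDiagonal M).charpoly = ∏ k, (M k).charpoly := by
  have h : (Matrix.blockDiagonal M).charmatrix = Matrix.blockDiagonal fun k ↦ (M k).charmatrix := by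
    ext ⟨i, k⟩ ⟨j, l⟩
    simp only [Matrix.charmatrix_apply, Matrix.blockDiagonal_apply, Matrix.diagonal_apply,
      Prod.mk.injEq]
    grind
  rw [Matrix.charpoly, h, Matrix.det_blockDiagonal]
  rfl

theorem exists_skewSymm_charpoly_eq (k c : ℕ) :
    ∃ K : skewSymm (2 * k + c), (K : Matrix (Fin (2 * k + c)) (Fin (2 * k + c)) ℝ).charpoly =
      (X ^ 2 + 1) ^ k * X ^ c := by
  let J : Matrix (Fin 2) (Fin 2) ℝ := !![0, 1; -1, 0]
  have hJ : Jᵀ = -J := by ext i j; fin_cases i <;> fin_cases j <;> simp [J]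
  have hJ' : J.charpoly = X ^ 2 + 1 := by simp [Matrix.charpoly_fin_two, Matrix.trace_fin_two, J]
  let A := Matrix.fromBlocks (Matrix.blockDiagonal fun _ : Fin k ↦ J) 0 0
    (0 : Matrix (Fin c) (Fin c) ℝ)
  have hA : Aᵀ = -A := by
    simp [A, Matrix.fromBlocks_transpose, Matrix.fromBlocks_neg, Matrix.blockDiagonal_transpose,
      hJ, ← Matrix.blockDiagonal_neg, Pi.neg_def]
  let e : (Fin 2 × Fin k) ⊕ Fin c ≃ Fin (2 * k + c) := Fintype.equivFinOfCardEq (by simp)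
  refine ⟨⟨A.reindex e e, congrArg (Matrix.reindex e e) hA⟩, ?_⟩
  rw [Matrix.charpoly_reindex, Matrix.charpoly_fromBlocks_zero₁₂, charpoly_blockDiagonal]
  simp [hJ']

theorem rootMultiplicity_mul_X_sub_C_pow_of_not_isRoot {R : Type*} [CommRing R] {p : R[X]}
    {a : R} (h : ¬p.IsRoot a) (n : ℕ) : (p * (X - C a) ^ n).rootMultiplicity a = n := by
  have hp : p ≠ 0 := by
    rintro rfl
    simp at h
  rw [rootMultiplicity_mul_X_sub_C_pow hp, rootMultiplicity_eq_zero h, zero_add]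

theorem exists_skewSymm_nullity_eq (k c : ℕ) :
    ∃ K : skewSymm (2 * k + c),
      nullity (K : Matrix (Fin (2 * k + c)) (Fin (2 * k + c)) ℝ) = c := by
  obtain ⟨K, hK⟩ := exists_skewSymm_charpoly_eq k c
  refine ⟨K, ?_⟩
  rw [nullity_eq_rootMultiplicity_zero, hK, ← sub_zero X, ← C_0]
  exact rootMultiplicity_mul_X_sub_C_pow_of_not_isRoot (by simp) c

theorem nonempty_eigenpairs (k c : ℕ) : (eigenpairs (2 * k + c) k).Nonempty := by
  obtain ⟨K, hK⟩ := exists_skewSymm_charpoly_eq k c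
  have hfactor : (X ^ 2 + 1 : ℂ[X]) = (X + C Complex.I) * (X - C Complex.I) := by
    have hI : (C Complex.I * C Complex.I : ℂ[X]) = -1 := by rw [← C_mul]; simp
    linear_combination hI
  have hcharpoly : (complexify (K : Matrix (Fin (2 * k + c)) (Fin (2 * k + c)) ℝ)).charpoly =
      (X + C Complex.I) ^ k * X ^ c * (X - C Complex.I) ^ k := by
    simp only [charpoly_complexify, hK, Polynomial.map_mul, Polynomial.map_pow, Polynomial.map_add,
      map_X, Polynomial.map_one, hfactor, mul_pow]
    ring
  refine ⟨(K, 1), one_ne_zero, ?_⟩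
  have h : skewPencil _ (K, 1) = complexify (K : Matrix (Fin (2 * k + c)) (Fin (2 * k + c)) ℝ) -
    Complex.I • 1 := by simp [skewPencil]
  rw [h, nullity_sub_smul_one_eq_rootMultiplicity
    (skewAdjoint.isStarNormal_of_mem (conjTranspose_complexify K)), hcharpoly]
  exact rootMultiplicity_mul_X_sub_C_pow_of_not_isRoot (by simp) k

end Rotations

section Codimension

variable {n : ℕ}

theorem hasCodim_le_nullity {c : ℕ} (hc : c ≤ n) (heven : Even (n - c)) :
    HasCodim {K : skewSymm n | c ≤ nullity (K : Matrix (Fin n) (Fin n) ℝ)} (c.choose 2) := by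
  obtain ⟨k, hk⟩ := heven
  obtain rfl : n = 2 * k + c := by lia
  exact (codimAtLeast_le_nullity _ c).hasCodim (isSubmanifoldOfCodim_nullity_eq _ c)
    (fun _ hK ↦ hK.ge) (exists_skewSymm_nullity_eq k c)

theorem hasCodim_repeatedZeroSkew_of_even (hn : Even n) (h2 : 2 ≤ n) :
    HasCodim (repeatedZeroSkew n) 1 := by
  rw [repeatedZeroSkew_eq_two_le_nullity]
  exact hasCodim_le_nullity (c := 2) h2 ((Nat.even_sub h2).2 (iff_of_true hn even_two))

theorem hasCodim_repeatedZeroSkew_of_odd (hn : Odd n) (h3 : 3 ≤ n) :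
    HasCodim (repeatedZeroSkew n) 3 := by
  rw [repeatedZeroSkew_eq_three_le_nullity hn]
  exact hasCodim_le_nullity (c := 3) h3 (Nat.Odd.sub_odd hn (by decide : Odd 3))

theorem hasCodim_repeatedNonzeroSkew (hn : 4 ≤ n) : HasCodim (repeatedNonzeroSkew n) 3 := by
  obtain ⟨c, rfl⟩ := Nat.exists_eq_add_of_le hn
  obtain ⟨p, hp⟩ := nonempty_eigenpairs 2 c
  obtain ⟨W, hW, hM⟩ := exists_isSubmanifoldOfCodim_image_fst_eigenpairs two_ne_zero hp
  exact (codimAtLeast_repeatedNonzeroSkew _).hasCodim hM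
    ((Set.image_mono Set.inter_subset_left).trans (image_fst_eigenpairs_subset le_rfl))
    ⟨p.1, p, ⟨hp, mem_of_mem_nhds hW⟩, rfl⟩

end Codimension

theorem mainTheorem1 (n : ℕ) :
    -- derogatory skew-symmetric matrices
    (Even n → 2 ≤ n → HasCodim (derogatorySkew n) 1) ∧
    (Odd n → 3 ≤ n → HasCodim (derogatorySkew n) 3) ∧
    -- repeated nonzero eigenvalues
    (4 ≤ n → HasCodim (repeatedNonzeroSkew n) 3) ∧
    (n ≤ 3 → repeatedNonzeroSkew n = ∅) ∧
    -- in the even case, codimension 1 comes from a double eigenvalue at 0, i.e. from `det K = 0`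
    (Even n → 2 ≤ n →
      repeatedZeroSkew n = {K : skewSymm n | (K : Matrix (Fin n) (Fin n) ℝ).det = 0} ∧
      HasCodim {K : skewSymm n | (K : Matrix (Fin n) (Fin n) ℝ).det = 0} 1 ∧
      derogatorySkew n =
        {K : skewSymm n | (K : Matrix (Fin n) (Fin n) ℝ).det = 0} ∪ repeatedNonzeroSkew n) := by
  have hzero := hasCodim_repeatedZeroSkew_of_even (n := n)
  have hdet := repeatedZeroSkew_eq_det_eq_zero (n := n)
  have hnonzero := codimAtLeast_repeatedNonzeroSkew n
  refine ⟨fun hn h2 ↦ ?_, fun hn h3 ↦ ?_, hasCodim_repeatedNonzeroSkew,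
    repeatedNonzeroSkew_eq_empty, fun hn h2 ↦ ⟨hdet hn, hdet hn ▸ hzero hn h2, ?_⟩⟩
  · rw [derogatorySkew_eq_union]
    exact (hzero hn h2).union (hnonzero.mono (by norm_num))
  · rw [derogatorySkew_eq_union]
    exact (hasCodim_repeatedZeroSkew_of_odd hn h3).union hnonzero
  · rw [derogatorySkew_eq_union, hdet hn]
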